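/- Fix $\gamma>2$. There is a constant $C>0$, depending only on $\gamma$, such that the following holds for all $\alpha_0,\alpha_1,\kappa>0$. Let $\Omega$ be a set, and let $a:\mathbb R\times\Omega\to[0,1]$ be such that $\sqrt{a(\cdot,\omega)}$ is $\kappa$-Lipschitz for every $\omega\in\Omega$. Let $H:\mathbb R\times\mathbb R\times\Omega\to\mathbb R$ satisfy, for all $x,y,p,q\in\mathbb R$ and $\omega\in\Omega$, $$\alpha_0|p|^\gamma-\tfrac1{\alpha_0}\le H(x,p,\omega)\le\alpha_1(|p|^\gamma+1),$$ $$|H(x,p,\omega)-H(x,q,\omega)|\le\alpha_1(|p|+|q|+1)^{\gamma-1}|p-q|,$$ $$|H(x,p,\omega)-H(y,p,\omega)|\le\alpha_1(|p|^\gamma+1)|x-y|.$$ For $\omega\in\Omega$ and $\lambda\in\mathbb R$ consider in $\mathbb R$ the equations $$(\mathrm{HJ}_\lambda)\quad a(x,\omega)u''+H(x,u',\omega)=\lambda,\qquad\qquad(\mathrm{ODE}_\lambda)\quad a(x,\omega)f'+H(x,f,\omega)=\lambda .$$ A continuous function $u:\mathbb R\to\mathbb R$ is a viscosity subsolution (respectively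 supersolution) of $(\mathrm{HJ}_\lambda)$ if $a(x,\omega)\varphi''(x)+H(x,\varphi'(x),\omega)\ge\lambda$ (respectively $\le\lambda$) whenever $\varphi\in C^2(\mathbb R)$ and $u-\varphi$ has a local maximum (respectively minimum) at $x$; it is a viscosity solution if it is both. Let $$\lambda_0(\omega)=\inf\{\lambda\in\mathbb R:(\mathrm{HJ}_\lambda)\text{ has a continuous viscosity supersolution}\}.$$ Let $\omega\in\Omega$ and $\lambda\ge\lambda_0(\omega)$. Then: 1. If $a(x,\omega)>0$ for all $x\in\mathbb R$, then a function $f:\mathbb R\to\mathbb R$ is a $C^1$ solution of $(\mathrm{ODE}_\lambda)$ if and only if there is a viscosity solution $u$ of $(\mathrm{HJ}_\lambda)$ that is differentiable on $\mathbb R$ with $u'=f$. The implication from left to right holds also without the positivity of $a(\cdot,\omega)$. 2. Every $C^1$ solution $f$ of $(\mathrm{ODE}_\lambda)$ satisfies $\|f\|_\infty=\sup_{\mathbb R}|f|\le K$, where $$K=C\left(\left(\kappa\,\frac{\sqrt{1+\alpha_1+|\lambda|}}{\alpha_0}\right)^{\frac2{\gamma-1}}+\left(\frac{1+\lambda\alpha_0}{\alpha_0^2}\right)^{\frac1\gamma}\right)>0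 .$$ -/

import Mathlib

/-- Standing assumptions on a diffusion coefficient `a : ℝ × Ω → [0,1]` other than its positivity:
it takes values in `[0,1]`, and `√a(·,ω)` is `κ`-Lipschitz for every `ω`. -/
structure IsDiffusionCoeff {Ω : Type*} (κ : ℝ) (a : ℝ → Ω → ℝ) : Prop where
  nonneg : ∀ x ω, 0 ≤ a x ω
  le_one : ∀ x ω, a x ω ≤ 1
  sqrt_lipschitz : ∀ x y ω, |Real.sqrt (a x ω) - Real.sqrt (a y ω)| ≤ κ * |x - y|

/-- The class `ℋ(α₀, α₁, γ)` of Hamiltonians `H(x, p, ω)`. -/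
structure IsHamiltonian {Ω : Type*} (α₀ α₁ γ : ℝ) (H : ℝ → ℝ → Ω → ℝ) : Prop where
  lower_bound : ∀ x p ω, α₀ * |p| ^ γ - 1 / α₀ ≤ H x p ω
  upper_bound : ∀ x p ω, H x p ω ≤ α₁ * (|p| ^ γ + 1)
  lipschitz_p : ∀ x p q ω,
    |H x p ω - H x q ω| ≤ α₁ * (|p| + |q| + 1) ^ (γ - 1) * |p - q|
  lipschitz_x : ∀ x y p ω, |H x p ω - H y p ω| ≤ α₁ * (|p| ^ γ + 1) * |x - y|

/-- `u` is a (continuous) viscosity subsolution of `b(x) u'' + G(x, u') = lam` in `ℝ`: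
if a `C²` function `φ` touches `u` from above at `x`, then `b(x) φ''(x) + G(x, φ'(x)) ≥ lam`.
(The inequality has this direction because the second-order term enters with a plus sign.) -/
def IsViscositySubsolution (b : ℝ → ℝ) (G : ℝ → ℝ → ℝ) (lam : ℝ) (u : ℝ → ℝ) : Prop :=
  Continuous u ∧ ∀ (φ : ℝ → ℝ) (x : ℝ), ContDiff ℝ 2 φ →
    IsLocalMax (fun y => u y - φ y) x →
    lam ≤ b x * deriv (deriv φ) x + G x (deriv φ x)

/-- `u` is a (continuous) viscosity supersolution of `b(x) u'' + G(x, u') = lam` in `ℝ`: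
if a `C²` function `φ` touches `u` from below at `x`, then `b(x) φ''(x) + G(x, φ'(x)) ≤ lam`. -/
def IsViscositySupersolution (b : ℝ → ℝ) (G : ℝ → ℝ → ℝ) (lam : ℝ) (u : ℝ → ℝ) : Prop :=
  Continuous u ∧ ∀ (φ : ℝ → ℝ) (x : ℝ), ContDiff ℝ 2 φ →
    IsLocalMin (fun y => u y - φ y) x →
    b x * deriv (deriv φ) x + G x (deriv φ x) ≤ lam

/-- `u` is a viscosity solution of `b(x) u'' + G(x, u') = lam` in `ℝ`. -/
def IsViscositySolution (b : ℝ → ℝ) (G : ℝ → ℝ → ℝ) (lam : ℝ) (u : ℝ → ℝ) : Prop :=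
  IsViscositySubsolution b G lam u ∧ IsViscositySupersolution b G lam u

/-- `f` is a `C¹` solution of `b(x) f' + G(x, f) = lam` in `ℝ`. -/
def IsC1Solution (b : ℝ → ℝ) (G : ℝ → ℝ → ℝ) (lam : ℝ) (f : ℝ → ℝ) : Prop :=
  ContDiff ℝ 1 f ∧ ∀ x, b x * deriv f x + G x (f x) = lam

/-- The critical value `λ₀(ω)`: the infimum of the levels `lam` at which
`a(x,ω) u'' + H(x,u',ω) = lam` has a continuous viscosity supersolution. The infimum is taken in
the extended reals, so that no convention on empty or unbounded sets is involved. -/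
noncomputable def criticalValue {Ω : Type*} (a : ℝ → Ω → ℝ) (H : ℝ → ℝ → Ω → ℝ) (ω : Ω) : EReal :=
  ⨅ (lam : ℝ) (_ : ∃ u : ℝ → ℝ,
    IsViscositySupersolution (fun x => a x ω) (fun x p => H x p ω) lam u), (lam : EReal)

/-- The explicit bound
`K = C ((κ √(1 + α₁ + |lam|) / α₀)^(2/(γ-1)) + ((1 + lam α₀) / α₀²)^(1/γ))`. -/
noncomputable def gradientBound (C α₀ α₁ γ κ lam : ℝ) : ℝ :=
  C * ((κ * (Real.sqrt (1 + α₁ + |lam|) / α₀)) ^ (2 / (γ - 1)) +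
    ((1 + lam * α₀) / α₀ ^ 2) ^ (1 / γ))

open Set Filter Topology

/-! ### Second-order conditions and test functions -/

/-! A primitive of a `C¹` solution is a viscosity solution by the second-derivative test.
Conversely, let `u` be a differentiable viscosity solution with `a > 0`. As `H ≥ -1/α₀`, the
supersolution property gives `u'' ≤ (lam + 1/α₀)/a` in the viscosity sense, so `u` minus a `C²`
function is concave (`concaveOn_sub_of_viscosity`), and Darboux makes `f = u'` continuous. Then
`u''` equals the continuous function `(lam - H(x,f))/a` in the viscosity sense, and the concavity
argument from both sides identifies it with `f'`.

For the bound, a `log cos` barrier yields `lam ≥ -1/α₀`. Put `R = ((1 + lam α₀)/α₀²)^(1/γ)`, so that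
`α₀ R^γ = lam + 1/α₀`. Where `|f| > R`, the equation and `a ≤ 1` force `f' ≤ -α₀ (|f|^γ - R^γ)`. A
value of `f` above `R` would blow up to the left, one below `-R` to the right; hence `|f| ≤ R`,
which is the second term of `K` with `C = 1`. -/

/-- Second-order necessary condition at a local maximum. -/
theorem nonpos_of_isLocalMax_of_hasDerivAt {g g' : ℝ → ℝ} {x d : ℝ}
    (hg : ∀ᶠ y in 𝓝 x, HasDerivAt g (g' y) y) (hg' : HasDerivAt g' d x)
    (hmax : IsLocalMax g x) : d ≤ 0 := by
  by_contra! hd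
  have hder : deriv g =ᶠ[𝓝 x] g' := hg.mono fun y hy => hy.deriv
  have h2 : deriv (deriv g) x = d := hder.deriv_eq.trans hg'.deriv
  -- If `d > 0`, then `x` is also a local minimum, so `g` is locally constant and `d = 0`.
  have hmin : IsLocalMin g x := isLocalMin_of_deriv_deriv_pos (h2 ▸ hd)
    hmax.deriv_eq_zero hg.self_of_nhds.continuousAt
  have hconst : g =ᶠ[𝓝 x] fun _ => g x := by
    filter_upwards [hmax, hmin] with y h₁ h₂ using le_antisymm h₁ h₂
  have h3 : deriv g =ᶠ[𝓝 x] fun _ => 0 := by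
    filter_upwards [hconst.eventuallyEq_nhds] with y hy
    rw [hy.deriv_eq, deriv_const]
  rw [h3.deriv_eq, deriv_const] at h2
  exact hd.ne h2

theorem ContDiff.hasDerivAt_deriv {φ : ℝ → ℝ} (hφ : ContDiff ℝ 2 φ) (x : ℝ) :
    HasDerivAt φ (deriv φ x) x ∧ HasDerivAt (deriv φ) (deriv (deriv φ) x) x := by
  have h := (contDiff_succ_iff_deriv (n := 1)).1 hφ
  exact ⟨(h.1 x).hasDerivAt, ((h.2.2.differentiable (by norm_num)) x).hasDerivAt⟩

theorem hasDerivAt_quadratic (A p d x t : ℝ) :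
    HasDerivAt (fun t => A + p * (t - x) + d / 2 * (t - x) ^ 2) (p + d * (t - x)) t := by
  have h := ((hasDerivAt_id t).sub_const x)
  refine (((h.const_mul p).const_add A).add ((h.pow 2).const_mul (d / 2))).congr_deriv ?_
  push_cast
  simp only [id]
  ring

theorem hasDerivAt_affine (p d x t : ℝ) :
    HasDerivAt (fun t => p + d * (t - x)) d t := by
  simpa using (((hasDerivAt_id t).sub_const x).const_mul d).const_add p

theorem deriv_quadratic (A p d x : ℝ) :
    deriv (fun t => A + p * (t - x) + d / 2 * (t - x) ^ 2) = fun t => p + d * (t - x) :=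
  funext fun t => (hasDerivAt_quadratic A p d x t).deriv

/-- The supersolution inequality may be tested with functions that are merely differentiable near
the contact point and twice differentiable there. -/
theorem IsViscositySupersolution.le_of_hasDerivAt {b : ℝ → ℝ} {G : ℝ → ℝ → ℝ} {lam : ℝ}
    {u : ℝ → ℝ} (hu : IsViscositySupersolution b G lam u) {φ φ' : ℝ → ℝ} {x d : ℝ}
    (hφ : ∀ᶠ y in 𝓝 x, HasDerivAt φ (φ' y) y) (hφ' : HasDerivAt φ' d x)
    (hmin : IsLocalMin (fun y => u y - φ y) x) : b x * d + G x (φ' x) ≤ lam := by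
  have key : ∀ ε > 0, b x * (d - ε) + G x (φ' x) ≤ lam := by
    intro ε hε
    -- Lowering the second derivative by `ε` makes this quadratic touch `φ`, hence `u` up to a
    -- constant, from below at `x`.
    set q : ℝ → ℝ := fun t => φ x + φ' x * (t - x) + (d - ε) / 2 * (t - x) ^ 2 with hq
    have hq1 : deriv q = fun t => φ' x + (d - ε) * (t - x) := deriv_quadratic _ _ _ _
    have hq2 : deriv (deriv q) x = d - ε := by rw [hq1]; exact (hasDerivAt_affine _ _ _ _).deriv
    have hder : ∀ᶠ y in 𝓝 x,
        HasDerivAt (fun t => φ t - q t) (φ' y - (φ' x + (d - ε) * (y - x))) y :=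
      hφ.mono fun y hy => hy.sub (hasDerivAt_quadratic _ _ _ _ _)
    have hder1 : deriv (fun t => φ t - q t) =ᶠ[𝓝 x]
        fun y => φ' y - (φ' x + (d - ε) * (y - x)) := hder.mono fun y hy => hy.deriv
    have hder2 : deriv (deriv fun t => φ t - q t) x = ε := by
      exact hder1.deriv_eq.trans
        ((hφ'.sub (hasDerivAt_affine _ _ _ _)).deriv.trans (by ring))
    have hloc : IsLocalMin (fun t => φ t - q t) x :=
      isLocalMin_of_deriv_deriv_pos (hder2 ▸ hε) (by rw [hder1.eq_of_nhds]; ring)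
        hder.self_of_nhds.continuousAt
    have hqmin : IsLocalMin (fun y => u y - q y) x := by
      filter_upwards [hmin, hloc] with y h₁ h₂
      linarith
    have := hu.2 q x (by fun_prop) hqmin
    rw [hq2, hq1] at this
    simpa using this
  have hlim : Tendsto (fun ε : ℝ => b x * (d - ε) + G x (φ' x)) (𝓝[>] 0)
      (𝓝 (b x * (d - 0) + G x (φ' x))) :=
    ((by fun_prop : Continuous fun ε : ℝ => b x * (d - ε) + G x (φ' x)).tendsto 0).mono_left
      nhdsWithin_le_nhds
  simpa using le_of_tendsto hlim (eventually_mem_nhdsWithin.mono key)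

/-! ### Classical solutions are viscosity solutions -/

theorem isViscositySolution_of_hasDerivAt {b : ℝ → ℝ} {G : ℝ → ℝ → ℝ} {lam : ℝ} {u f f' : ℝ → ℝ}
    (hb : ∀ x, 0 ≤ b x) (hu : ∀ x, HasDerivAt u (f x) x) (hf : ∀ x, HasDerivAt f (f' x) x)
    (heq : ∀ x, b x * f' x + G x (f x) = lam) : IsViscositySolution b G lam u := by
  have hcont : Continuous u := continuous_iff_continuousAt.2 fun x => (hu x).continuousAt
  refine ⟨⟨hcont, fun φ x hφ hmax => ?_⟩, ⟨hcont, fun φ x hφ hmin => ?_⟩⟩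
  · have h1 : f x - deriv φ x = 0 :=
      hmax.hasDerivAt_eq_zero ((hu x).sub (hφ.hasDerivAt_deriv x).1)
    have h2 := nonpos_of_isLocalMax_of_hasDerivAt
      (.of_forall fun y => (hu y).sub (hφ.hasDerivAt_deriv y).1)
      ((hf x).sub (hφ.hasDerivAt_deriv x).2) hmax
    rw [← sub_eq_zero.1 h1, ← heq x]
    gcongr
    · exact hb x
    · linarith
  · have h1 : f x - deriv φ x = 0 :=
      hmin.hasDerivAt_eq_zero ((hu x).sub (hφ.hasDerivAt_deriv x).1)
    have hmax : IsLocalMax (fun y => φ y - u y) x := by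
      simpa using hmin.neg
    have h2 := nonpos_of_isLocalMax_of_hasDerivAt
      (.of_forall fun y => (hφ.hasDerivAt_deriv y).1.sub (hu y))
      ((hφ.hasDerivAt_deriv x).2.sub (hf x)) hmax
    rw [← sub_eq_zero.1 h1, ← heq x]
    gcongr
    · exact hb x
    · linarith

theorem Continuous.exists_hasDerivAt {f : ℝ → ℝ} (hf : Continuous f) :
    ∃ u : ℝ → ℝ, ∀ x, HasDerivAt u (f x) x :=
  ⟨fun x => ∫ t in (0 : ℝ)..x, f t, fun x => hf.integral_hasStrictDerivAt 0 x |>.hasDerivAt⟩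

theorem IsC1Solution.exists_isViscositySolution {b : ℝ → ℝ} {G : ℝ → ℝ → ℝ} {lam : ℝ} {f : ℝ → ℝ}
    (hb : ∀ x, 0 ≤ b x) (hf : IsC1Solution b G lam f) :
    ∃ u : ℝ → ℝ, IsViscositySolution b G lam u ∧ ∀ x, HasDerivAt u (f x) x := by
  obtain ⟨u, hu⟩ := hf.1.continuous.exists_hasDerivAt
  exact ⟨u, isViscositySolution_of_hasDerivAt hb hu
    (fun x => ((hf.1.differentiable (by norm_num)) x).hasDerivAt) hf.2, hu⟩

/-! ### Differentiable viscosity solutions are classical -/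

/-- A continuous function satisfying `w'' ≤ h` in the viscosity sense differs by a concave function
from any `V` with `V'' = h`. -/
theorem concaveOn_sub_of_viscosity {w V V' h : ℝ → ℝ} (hw : Continuous w)
    (hV : ∀ x, HasDerivAt V (V' x) x) (hV' : ∀ x, HasDerivAt V' (h x) x) (hh : Continuous h)
    (hvisc : ∀ (φ : ℝ → ℝ) (x : ℝ), ContDiff ℝ 2 φ → IsLocalMin (fun y => w y - φ y) x →
      deriv (deriv φ) x ≤ h x) :
    ConcaveOn ℝ univ fun x => w x - V x := by
  have hdV : deriv V = V' := funext fun x => (hV x).deriv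
  have hdV' : deriv V' = h := funext fun x => (hV' x).deriv
  have hV'C : ContDiff ℝ 1 V' := contDiff_one_iff_deriv.2
    ⟨fun x => (hV' x).differentiableAt, hdV' ▸ hh⟩
  have hVC : ContDiff ℝ 2 V := (contDiff_succ_iff_deriv (n := 1)).2
    ⟨fun x => (hV x).differentiableAt, by simp, hdV ▸ hV'C⟩
  refine concaveOn_of_slope_anti_adjacent convex_univ fun {x z y} _ _ hxz hzy => ?_
  by_contra! hlt
  set F : ℝ → ℝ := fun t => w t - V t with hF
  have hFc : Continuous F := hw.sub hVC.continuous
  set s := (F y - F x) / (y - x) with hs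
  have hxy : 0 < y - x := by linarith
  have hsxy : s * (y - x) = F y - F x := by rw [hs]; field_simp
  have hz : F z - F x - s * (z - x) < 0 := by
    have h1 : 0 < z - x := by linarith
    have h2 : 0 < y - z := by linarith
    rw [div_lt_div_iff₀ h1 h2] at hlt
    have h3 : (F z - F x - s * (z - x)) * (y - x) < 0 := by
      have : (F z - F x - s * (z - x)) * (y - x)
        = (F z - F x) * (y - x) - (s * (y - x)) * (z - x) := by ring
      rw [this, hsxy]
      simp only [hF] at hlt ⊢
      nlinarith
    exact neg_of_mul_neg_left h3 hxy.le
  have hprod : 0 < (z - x) * (y - z) := mul_pos (by linarith) (by linarith)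
  obtain ⟨ε, hε, hεz⟩ : ∃ ε > 0, F z - F x - s * (z - x) + ε * ((z - x) * (y - z)) < 0 := by
    refine ⟨-(F z - F x - s * (z - x)) / (2 * ((z - x) * (y - z))), by
      apply div_pos <;> linarith, ?_⟩
    have : -(F z - F x - s * (z - x)) / (2 * ((z - x) * (y - z))) * ((z - x) * (y - z))
        = -(F z - F x - s * (z - x)) / 2 := by field_simp
    rw [this]; linarith
  -- The chord of `F` over `[x, y]` bent down by `ε (t - x)(y - t)`: it meets `F` at both ends,
  -- still exceeds it at `z`, and has `q'' = 2ε`. So `F - q` has an interior minimum, where `V + q`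
  -- violates `w'' ≤ h`.
  set q : ℝ → ℝ := fun t => F x + (s - ε * (y - x)) * (t - x) + (2 * ε) / 2 * (t - x) ^ 2 with hq
  have hqeq : ∀ t, F t - q t = F t - F x - s * (t - x) + ε * ((t - x) * (y - t)) := by
    intro t; simp only [hq]; ring
  have hqc : Continuous fun t => F t - q t := by fun_prop
  obtain ⟨m, hm, hmin⟩ := isCompact_Icc.exists_isMinOn (nonempty_Icc.2 (hxz.trans hzy).le)
    hqc.continuousOn
  have hmz : F m - q m < 0 := (hmin ⟨hxz.le, hzy.le⟩).trans_lt ((hqeq z).trans_lt hεz)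
  have hm' : m ∈ Ioo x y := by
    refine ⟨lt_of_le_of_ne hm.1 ?_, lt_of_le_of_ne hm.2 ?_⟩
    · rintro rfl; rw [hqeq] at hmz; simp at hmz
    · rintro rfl; rw [hqeq, hsxy] at hmz; simp at hmz
  have hloc := hmin.isLocalMin (Icc_mem_nhds hm'.1 hm'.2)
  have hd1 : deriv (fun t => V t + q t) = fun t => V' t + (s - ε * (y - x) + 2 * ε * (t - x)) :=
    funext fun t => ((hV t).add (hasDerivAt_quadratic _ _ _ _ _)).deriv
  have hd2 : deriv (deriv fun t => V t + q t) m = h m + 2 * ε := by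
    rw [hd1]; exact ((hV' m).add (hasDerivAt_affine _ _ _ _)).deriv
  have := hvisc (fun t => V t + q t) m (hVC.add (by fun_prop))
    (by simpa only [hF, sub_sub] using hloc)
  rw [hd2] at this
  linarith

/-- Darboux: an antitone derivative is continuous. -/
theorem Antitone.continuous_of_hasDerivAt {w g : ℝ → ℝ} (hg : Antitone g)
    (hw : ∀ x, HasDerivAt w (g x) x) : Continuous g := by
  -- The range of a derivative is an interval, which leaves a monotone function no room to jump.
  have hoc : OrdConnected (range g) := by
    have := (ordConnected_univ (α := ℝ)).image_hasDerivWithinAt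
      (f := w) (f' := g) fun x _ => (hw x).hasDerivWithinAt
    rwa [image_univ] at this
  refine continuous_iff_continuousAt.2 fun x => tendsto_order.2 ⟨fun b hb => ?_, fun b hb => ?_⟩
  · obtain ⟨y, hy, hby⟩ : ∃ y > x, b < g y := by
      by_contra! hcon
      obtain ⟨m, hbm, hmx⟩ := exists_between hb
      obtain ⟨c, rfl⟩ := hoc.out (mem_range_self (x + 1)) (mem_range_self x)
        ⟨((hcon (x + 1) (by linarith)).trans_lt hbm).le, hmx.le⟩
      exact hbm.not_ge (hcon c (hg.reflect_lt hmx))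
    exact (eventually_lt_nhds hy).mono fun z hz => hby.trans_le (hg (le_of_lt hz))
  · obtain ⟨y, hy, hby⟩ : ∃ y < x, g y < b := by
      by_contra! hcon
      obtain ⟨m, hxm, hmb⟩ := exists_between hb
      obtain ⟨c, rfl⟩ := hoc.out (mem_range_self x) (mem_range_self (x - 1))
        ⟨hxm.le, (hmb.trans_le (hcon (x - 1) (by linarith))).le⟩
      exact hmb.not_ge (hcon c (hg.reflect_lt hxm))
    exact (eventually_gt_nhds hy).mono fun z hz => (hg (le_of_lt hz)).trans_lt hby

theorem ConcaveOn.antitone_of_hasDerivAt {w g : ℝ → ℝ} (hc : ConcaveOn ℝ univ w)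
    (hw : ∀ x, HasDerivAt w (g x) x) : Antitone g := by
  have hd : deriv w = g := funext fun x => (hw x).deriv
  have := hc.antitoneOn_deriv fun x _ => (hw x).differentiableAt
  rw [hd] at this
  exact antitoneOn_univ.1 this

/-- If `u' = f` and `u'' = h` in the viscosity sense with `h` continuous, then `f' = h`. -/
theorem hasDerivAt_of_viscosity {u f h : ℝ → ℝ} (hu : ∀ x, HasDerivAt u (f x) x)
    (hh : Continuous h)
    (hsub : ∀ (φ : ℝ → ℝ) (x : ℝ), ContDiff ℝ 2 φ → IsLocalMax (fun y => u y - φ y) x →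
      h x ≤ deriv (deriv φ) x)
    (hsup : ∀ (φ : ℝ → ℝ) (x : ℝ), ContDiff ℝ 2 φ → IsLocalMin (fun y => u y - φ y) x →
      deriv (deriv φ) x ≤ h x) (x : ℝ) : HasDerivAt f (h x) x := by
  have huc : Continuous u := continuous_iff_continuousAt.2 fun x => (hu x).continuousAt
  obtain ⟨V', hV'⟩ := hh.exists_hasDerivAt
  obtain ⟨V, hV⟩ := (continuous_iff_continuousAt.2 fun x =>
    (hV' x).continuousAt : Continuous V').exists_hasDerivAt
  have h1 : Antitone fun x => f x - V' x :=
    (concaveOn_sub_of_viscosity huc hV hV' hh hsup).antitone_of_hasDerivAt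
      fun x => (hu x).sub (hV x)
  -- The subsolution property of `u` is the supersolution property of `-u`, with `-h`.
  have h2 : Antitone fun x => - f x - - V' x := by
    refine (concaveOn_sub_of_viscosity (h := fun x => - h x) huc.neg (fun x => (hV x).neg)
      (fun x => (hV' x).neg) hh.neg fun φ x hφ hmin => ?_).antitone_of_hasDerivAt
      fun x => (hu x).neg.sub (hV x).neg
    have := hsub (fun y => - φ y) x hφ.neg (by
      have := hmin.neg
      refine this.congr (.of_forall fun y => ?_)
      simp; ring)
    have hd : deriv (fun y => - φ y) = fun y => - deriv φ y := funext fun y => deriv.fun_neg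
    rw [hd, deriv.fun_neg] at this
    linarith
  have hconst : ∀ y, f y = V' y + (f x - V' x) := by
    intro y
    rcases le_total x y with hxy | hxy
    · have := h1 hxy; have := h2 hxy; simp only at *; linarith
    · have := h1 hxy; have := h2 hxy; simp only at *; linarith
  rw [funext hconst]
  exact (hV' x).add_const _

section Structure

variable {Ω : Type*} {κ α₀ α₁ γ : ℝ} {a : ℝ → Ω → ℝ} {H : ℝ → ℝ → Ω → ℝ}

theorem IsDiffusionCoeff.continuous (ha : IsDiffusionCoeff κ a) (ω : Ω) :
    Continuous fun x => a x ω := by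
  have h : Continuous fun x => Real.sqrt (a x ω) := by
    refine continuous_iff_continuousAt.2 fun x => ?_
    rw [ContinuousAt, tendsto_iff_dist_tendsto_zero]
    refine squeeze_zero (fun _ => dist_nonneg) (fun y => ha.sqrt_lipschitz y x ω) ?_
    have : Continuous fun y => κ * |y - x| := by fun_prop
    simpa using this.tendsto x
  exact (h.pow 2).congr fun x => Real.sq_sqrt (ha.nonneg x ω)

theorem IsHamiltonian.continuous_comp (hγ : 2 < γ) (hH : IsHamiltonian α₀ α₁ γ H) (ω : Ω)
    {f : ℝ → ℝ} (hf : Continuous f) : Continuous fun x => H x (f x) ω := by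
  refine continuous_iff_continuousAt.2 fun x => ?_
  rw [ContinuousAt, tendsto_iff_dist_tendsto_zero]
  refine squeeze_zero (g := fun y => α₁ * (|f y| + |f x| + 1) ^ (γ - 1) * |f y - f x|
    + α₁ * (|f x| ^ γ + 1) * |y - x|) (fun _ => dist_nonneg) (fun y => ?_) ?_
  · rw [Real.dist_eq]
    exact (abs_sub_le _ (H y (f x) ω) _).trans
      (add_le_add (hH.lipschitz_p y _ _ ω) (hH.lipschitz_x y x _ ω))
  · have h1 : Continuous fun y => (|f y| + |f x| + 1) ^ (γ - 1) :=
      Continuous.rpow_const (by fun_prop) fun _ => Or.inr (by linarith)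
    have : Continuous fun y => α₁ * (|f y| + |f x| + 1) ^ (γ - 1) * |f y - f x|
      + α₁ * (|f x| ^ γ + 1) * |y - x| := by fun_prop
    simpa using this.tendsto x

theorem IsViscositySolution.isC1Solution (hγ : 2 < γ) (h₀ : 0 < α₀)
    (ha : IsDiffusionCoeff κ a) (hH : IsHamiltonian α₀ α₁ γ H) {ω : Ω} (hpos : ∀ x, 0 < a x ω)
    {lam : ℝ} {u f : ℝ → ℝ}
    (hsol : IsViscositySolution (fun x => a x ω) (fun x p => H x p ω) lam u)
    (hu : ∀ x, HasDerivAt u (f x) x) :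
    IsC1Solution (fun x => a x ω) (fun x p => H x p ω) lam f := by
  obtain ⟨⟨huc, hsub⟩, ⟨_, hsup⟩⟩ := hsol
  have hac := ha.continuous ω
  have hfc : Continuous f := by
    have hh : Continuous fun x => (lam + 1 / α₀) / a x ω :=
      continuous_const.div hac fun x => (hpos x).ne'
    obtain ⟨V', hV'⟩ := hh.exists_hasDerivAt
    have hV'c : Continuous V' := continuous_iff_continuousAt.2 fun x => (hV' x).continuousAt
    obtain ⟨V, hV⟩ := hV'c.exists_hasDerivAt
    have hd : ∀ x, HasDerivAt (fun x => u x - V x) (f x - V' x) x := fun x => (hu x).sub (hV x)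
    have hanti := (concaveOn_sub_of_viscosity huc hV hV' hh fun φ x hφ hmin => by
      have h1 := hsup φ x hφ hmin
      have h2 := hH.lower_bound x (deriv φ x) ω
      have h3 : 0 ≤ α₀ * |deriv φ x| ^ γ := by positivity
      rw [le_div_iff₀ (hpos x)]
      simp only at h1
      linarith).antitone_of_hasDerivAt hd
    exact ((hanti.continuous_of_hasDerivAt hd).add hV'c).congr fun x => sub_add_cancel _ _
  have hh : Continuous fun x => (lam - H x (f x) ω) / a x ω :=
    (continuous_const.sub (hH.continuous_comp hγ ω hfc)).div hac fun x => (hpos x).ne'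
  have hf : ∀ x, HasDerivAt f ((lam - H x (f x) ω) / a x ω) x := by
    refine hasDerivAt_of_viscosity hu hh (fun φ x hφ hmax => ?_) (fun φ x hφ hmin => ?_)
    · have h1 : f x - deriv φ x = 0 :=
        hmax.hasDerivAt_eq_zero ((hu x).sub (hφ.hasDerivAt_deriv x).1)
      have h2 := hsub φ x hφ hmax
      rw [← sub_eq_zero.1 h1] at h2
      rw [div_le_iff₀ (hpos x)]
      simp only at h2
      linarith
    · have h1 : f x - deriv φ x = 0 :=
        hmin.hasDerivAt_eq_zero ((hu x).sub (hφ.hasDerivAt_deriv x).1)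
      have h2 := hsup φ x hφ hmin
      rw [← sub_eq_zero.1 h1] at h2
      rw [le_div_iff₀ (hpos x)]
      simp only at h2
      linarith
  refine ⟨contDiff_one_iff_deriv.2 ⟨fun x => (hf x).differentiableAt, ?_⟩, fun x => ?_⟩
  · rwa [funext fun x => (hf x).deriv]
  · have := (hpos x).ne'
    simp only [(hf x).deriv]
    field_simp
    ring

/-! ### Lower bound for the critical value -/

/-- Holds because `p² ≤ |p|^γ + 1` for `γ > 2`. It lets the coercivity of `H` absorb the term
`-p²/B` in the second derivative of the barrier. -/
theorem exists_sq_div_le (hγ : 2 < γ) (h₀ : 0 < α₀) {δ : ℝ} (hδ : 0 < δ) :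
    ∃ B > 0, ∀ p : ℝ, p ^ 2 / B ≤ α₀ * |p| ^ γ + δ := by
  refine ⟨1 / α₀ + 1 / δ, by positivity, fun p => ?_⟩
  have hB : 0 < 1 / α₀ + 1 / δ := by positivity
  rw [div_le_iff₀ hB, ← sq_abs]
  have hp := abs_nonneg p
  have h3 : 0 ≤ |p| ^ γ := by positivity
  have hexp : (α₀ * |p| ^ γ + δ) * (1 / α₀ + 1 / δ)
      = |p| ^ γ + 1 + (α₀ * |p| ^ γ * (1 / δ) + δ * (1 / α₀)) := by
    field_simp; ring
  have h4 : 0 ≤ α₀ * |p| ^ γ * (1 / δ) + δ * (1 / α₀) := by positivity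
  rw [hexp]
  rcases le_total |p| 1 with h | h
  · nlinarith
  · have := Real.rpow_le_rpow_of_exponent_le h hγ.le
    rw [Real.rpow_two] at this
    linarith

/-- A level at which a supersolution exists is at least `-1/α₀`: below it, the barrier
`B log cos(θ t)` touches any continuous function from below with the wrong inequality. -/
theorem IsViscositySupersolution.neg_inv_le (hγ : 2 < γ) (h₀ : 0 < α₀)
    (ha : IsDiffusionCoeff κ a) (hH : IsHamiltonian α₀ α₁ γ H) {ω : Ω} {lam : ℝ} {u : ℝ → ℝ}
    (hu : IsViscositySupersolution (fun x => a x ω) (fun x p => H x p ω) lam u) :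
    -(1 / α₀) ≤ lam := by
  by_contra! hlt
  set δ := -(lam + 1 / α₀) with hδ
  have hδ0 : 0 < δ := by linarith
  obtain ⟨B, hB, hBp⟩ := exists_sq_div_le hγ h₀ (show 0 < δ / 4 by linarith)
  -- The barrier `φ = B log cos(θ t)` satisfies `φ'' = -Bθ² - φ'²/B ≤ 0`. With `Bθ² = δ/4` and `a ≤
  -- 1`, `a φ'' + H(x, φ') ≥ -δ/2 - 1/α₀ > lam`.
  set θ := Real.sqrt (δ / (4 * B)) with hθ
  have hθ0 : 0 < θ := Real.sqrt_pos.2 (by positivity)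
  have hθ2 : B * θ ^ 2 = δ / 4 := by rw [hθ, Real.sq_sqrt (by positivity)]; field_simp
  set R := Real.pi / 2 / θ with hR
  have hR0 : 0 < R := by have := Real.pi_pos; positivity
  have hθR : θ * R = Real.pi / 2 := by rw [hR]; field_simp
  have hcos : ∀ t ∈ Ioo (-R) R, 0 < Real.cos (θ * t) := fun t ht =>
    Real.cos_pos_of_mem_Ioo ⟨by rw [← hθR]; nlinarith [ht.1], by rw [← hθR]; nlinarith [ht.2]⟩
  -- `ψ = exp((φ - u)/B)` stays continuous up to `±R`, where `φ` tends to `-∞` and `ψ` vanishes; its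
  -- maximum is thus interior.
  set ψ : ℝ → ℝ := fun t => Real.cos (θ * t) * Real.exp (-(u t / B)) with hψ
  have hψc : Continuous ψ := by
    have := hu.1
    fun_prop
  obtain ⟨x, hx, hmax⟩ := isCompact_Icc.exists_isMaxOn (nonempty_Icc.2 (by linarith : -R ≤ R))
    hψc.continuousOn
  have hx0 : 0 < ψ x := lt_of_lt_of_le (by simp only [hψ]; simp; positivity)
    (hmax (show (0 : ℝ) ∈ Icc (-R) R from ⟨by linarith, hR0.le⟩))
  have hx' : x ∈ Ioo (-R) R := by
    refine ⟨lt_of_le_of_ne hx.1 ?_, lt_of_le_of_ne hx.2 ?_⟩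
    · rintro rfl; simp [hψ, hθR] at hx0
    · rintro rfl; simp [hψ, hθR] at hx0
  have hnhds : Ioo (-R) R ∈ 𝓝 x := Ioo_mem_nhds hx'.1 hx'.2
  have hlog : ∀ t ∈ Ioo (-R) R, Real.log (ψ t) = Real.log (Real.cos (θ * t)) - u t / B := by
    intro t ht
    rw [hψ]
    simp only
    rw [Real.log_mul (hcos t ht).ne' (Real.exp_pos _).ne', Real.log_exp]; ring
  have hloc : IsLocalMin (fun t => u t - B * Real.log (Real.cos (θ * t))) x := by
    filter_upwards [hnhds] with t ht
    have h1 := Real.log_le_log (mul_pos (hcos t ht) (Real.exp_pos _))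
      (hmax (Ioo_subset_Icc_self ht))
    have h2 : Real.log (ψ t) ≤ Real.log (ψ x) := h1
    rw [hlog t ht, hlog x hx'] at h2
    have h3 := mul_le_mul_of_nonneg_left h2 hB.le
    have h4 : ∀ s, B * (s / B) = s := fun s => by field_simp
    rw [mul_sub, mul_sub, h4, h4] at h3
    linarith
  have hlin : ∀ t, HasDerivAt (fun t => θ * t) θ t := fun t => by
    simpa using (hasDerivAt_id t).const_mul θ
  have hd1 : ∀ᶠ t in 𝓝 x, HasDerivAt (fun t => B * Real.log (Real.cos (θ * t)))
      (-(B * θ) * Real.tan (θ * t)) t := by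
    filter_upwards [hnhds] with t ht
    refine ((((hlin t).cos).log (hcos t ht).ne').const_mul B).congr_deriv ?_
    rw [Real.tan_eq_sin_div_cos]; ring
  set p := -(B * θ) * Real.tan (θ * x) with hp
  have hd2 : HasDerivAt (fun t => -(B * θ) * Real.tan (θ * t)) (-(δ / 4) - p ^ 2 / B) x := by
    have hc := (hcos x hx').ne'
    refine (((Real.hasDerivAt_tan hc).comp x (hlin x)).const_mul (-(B * θ))).congr_deriv ?_
    rw [← hθ2, hp, Real.tan_eq_sin_div_cos]
    field_simp
    rw [← Real.sin_sq_add_cos_sq (θ * x)]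
    ring
  have h1 := hu.le_of_hasDerivAt hd1 hd2 hloc
  have h2 := hH.lower_bound x p ω
  have h3 := hBp p
  have h4 : 0 ≤ p ^ 2 / B := by positivity
  have h5 : (1 - a x ω) * (-(δ / 4) - p ^ 2 / B) ≤ 0 :=
    mul_nonpos_of_nonneg_of_nonpos (by linarith [ha.le_one x ω]) (by linarith)
  simp only [← hp] at h1
  linarith

theorem neg_inv_le_of_criticalValue_le (hγ : 2 < γ) (h₀ : 0 < α₀)
    (ha : IsDiffusionCoeff κ a) (hH : IsHamiltonian α₀ α₁ γ H) {ω : Ω} {lam : ℝ}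
    (hlam : criticalValue a H ω ≤ (lam : EReal)) : -(1 / α₀) ≤ lam := by
  have h : ((-(1 / α₀) : ℝ) : EReal) ≤ criticalValue a H ω :=
    le_iInf₂ fun _ ⟨_, hu⟩ => EReal.coe_le_coe_iff.2 (hu.neg_inv_le hγ h₀ ha hH)
  exact EReal.coe_le_coe_iff.1 (h.trans hlam)

/-! ### The uniform bound -/

/-- A global function cannot satisfy `g' ≥ c g²` above a positive level that it reaches. -/
theorem lt_of_mul_sq_le_deriv {g : ℝ → ℝ} {c M : ℝ} (hg : Differentiable ℝ g) (hc : 0 < c)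
    (hM : 0 < M) (h : ∀ x, M ≤ g x → c * g x ^ 2 ≤ deriv g x) (x₀ : ℝ) : g x₀ < M := by
  by_contra! hx₀
  have hge : ∀ x, x₀ ≤ x → M ≤ g x := fun x hx =>
    image_le_of_deriv_right_lt_deriv_boundary' (f := fun _ => M) (f' := fun _ => 0)
      (B' := deriv g) continuousOn_const (fun _ _ => hasDerivWithinAt_const _ _ _) hx₀
      hg.continuous.continuousOn (fun y _ => (hg y).hasDerivAt.hasDerivWithinAt)
      (fun y _ hy => by
        have := h y hy.le
        have : 0 < c * g y ^ 2 := by rw [← hy]; positivity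
        linarith) ⟨hx, le_rfl⟩
  -- Since `(1/g)' ≤ -c`, the positive function `1/g` would reach `0` by `x₀ + 1/(c g(x₀))`.
  have hder : ∀ x, x₀ ≤ x →
      HasDerivAt (fun x => (g x)⁻¹ + c * x) (-deriv g x / g x ^ 2 + c) x := fun x hx => by
    have hne : g x ≠ 0 := (hM.trans_le (hge x hx)).ne'
    exact (((hg x).hasDerivAt.inv hne).add ((hasDerivAt_id x).const_mul c)).congr_deriv (by simp)
  have hanti : AntitoneOn (fun x => (g x)⁻¹ + c * x) (Ici x₀) := by
    refine antitoneOn_of_deriv_nonpos (convex_Ici x₀)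
      (fun x hx => (hder x hx).continuousAt.continuousWithinAt)
      (fun x hx => (hder x (interior_subset hx)).differentiableAt.differentiableWithinAt)
      fun x hx => ?_
    have hx := interior_subset hx
    have hp : 0 < g x ^ 2 := pow_pos (hM.trans_le (hge x hx)) 2
    have := h x (hge x hx)
    rw [(hder x hx).deriv, neg_div]
    have := (le_div_iff₀ hp).2 this
    linarith
  have hx₁ : x₀ ≤ x₀ + (g x₀)⁻¹ / c := by
    have := inv_nonneg.2 (hM.le.trans hx₀)
    have : 0 ≤ (g x₀)⁻¹ / c := by positivity
    linarith
  have h1 := hanti self_mem_Ici hx₁ hx₁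
  have h2 : 0 < (g (x₀ + (g x₀)⁻¹ / c))⁻¹ := inv_pos.2 (hM.trans_le (hge _ hx₁))
  have h3 : c * (x₀ + (g x₀)⁻¹ / c) = c * x₀ + (g x₀)⁻¹ := by field_simp
  simp only at h1
  linarith

/-- Above a value `M > R`, a fixed fraction of `g^γ` survives the subtraction of `μ`, and `g^γ ≥
M^(γ-2) g²`: this reduces to quadratic blow-up. -/
theorem le_of_rpow_sub_le_deriv (hγ : 2 < γ) (h₀ : 0 < α₀) {μ R : ℝ} {g : ℝ → ℝ}
    (hR : 0 ≤ R) (hμR : α₀ * R ^ γ = μ)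
    (hg : Differentiable ℝ g) (h : ∀ x, R < g x → α₀ * g x ^ γ - μ ≤ deriv g x) (x : ℝ) :
    g x ≤ R := by
  by_contra! hx
  set M := g x with hM
  have hM0 : 0 < M := hR.trans_lt hx
  have hMR : R ^ γ < M ^ γ := Real.rpow_lt_rpow hR hx (by linarith)
  have hRγ : 0 ≤ R ^ γ := by positivity
  have hMγ : 0 < M ^ γ := by positivity
  -- The largest constant with `c₁ s^γ ≤ α₀ s^γ - μ` for all `s ≥ M`; equality at `s = M`.
  set c₁ := α₀ * (1 - R ^ γ / M ^ γ) with hc₁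
  have hc₁0 : 0 < c₁ := mul_pos h₀ (sub_pos.2 ((div_lt_one hMγ).2 hMR))
  refine (lt_of_mul_sq_le_deriv hg (c := c₁ * M ^ (γ - 2)) (by positivity) hM0
    (fun y hy => ?_) x).ne rfl
  refine le_trans ?_ (h y (hx.trans_le hy))
  have hy0 : 0 < g y := hM0.trans_le hy
  have h1 : M ^ (γ - 2) ≤ g y ^ (γ - 2) := Real.rpow_le_rpow hM0.le hy (by linarith)
  have h2 : g y ^ (γ - 2) * g y ^ 2 = g y ^ γ := by
    rw [← Real.rpow_two, ← Real.rpow_add hy0]; simp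
  have h3 : M ^ γ ≤ g y ^ γ := Real.rpow_le_rpow hM0.le hy (by linarith)
  calc c₁ * M ^ (γ - 2) * g y ^ 2 ≤ c₁ * g y ^ (γ - 2) * g y ^ 2 := by gcongr
    _ = α₀ * g y ^ γ - α₀ * (R ^ γ / M ^ γ * g y ^ γ) := by rw [mul_assoc, h2, hc₁]; ring
    _ ≤ α₀ * g y ^ γ - μ := by
      have : R ^ γ ≤ R ^ γ / M ^ γ * g y ^ γ := by
        rw [div_mul_eq_mul_div, le_div_iff₀ hMγ]; gcongr
      rw [← hμR]
      gcongr

theorem IsC1Solution.abs_le_rpow (hγ : 2 < γ) (h₀ : 0 < α₀) (ha : IsDiffusionCoeff κ a)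
    (hH : IsHamiltonian α₀ α₁ γ H) {ω : Ω} {lam : ℝ} (hlam : -(1 / α₀) ≤ lam) {f : ℝ → ℝ}
    (hf : IsC1Solution (fun x => a x ω) (fun x p => H x p ω) lam f) (x : ℝ) :
    |f x| ≤ ((1 + lam * α₀) / α₀ ^ 2) ^ (1 / γ) := by
  have hbase : 0 ≤ (1 + lam * α₀) / α₀ ^ 2 := by
    have : -(1 / α₀) * α₀ ≤ lam * α₀ := by gcongr
    have h1 : -(1 / α₀) * α₀ = -1 := by field_simp
    apply div_nonneg _ (by positivity)
    linarith
  set R := ((1 + lam * α₀) / α₀ ^ 2) ^ (1 / γ) with hR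
  have hR0 : 0 ≤ R := by positivity
  have hRγ : α₀ * R ^ γ = lam + 1 / α₀ := by
    rw [hR, ← Real.rpow_mul hbase, one_div_mul_cancel (by linarith), Real.rpow_one]
    field_simp; ring
  have hfd : Differentiable ℝ f := hf.1.differentiable (by norm_num)
  have key : ∀ y, R < |f y| → α₀ * |f y| ^ γ - (lam + 1 / α₀) ≤ -deriv f y := by
    intro y hy
    have h1 := hf.2 y
    have h2 := hH.lower_bound y (f y) ω
    have h3 : α₀ * R ^ γ < α₀ * |f y| ^ γ := by gcongr
    have h4 := ha.nonneg y ω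
    have h5 := ha.le_one y ω
    simp only at h1
    -- Negativity comes first: only for `f' < 0` does `a ≤ 1` give `f' ≤ a f'`.
    have h6 : a y ω * deriv f y < 0 := by linarith
    have h7 : deriv f y < 0 := neg_of_mul_neg_right h6 h4
    nlinarith
  refine abs_le.2 ⟨?_, ?_⟩
  · have := le_of_rpow_sub_le_deriv hγ h₀ hR0 hRγ (g := fun y => - f y) hfd.neg
      (fun y hy => by
        have hy' : |f y| = - f y := abs_of_neg (by linarith)
        have := key y (by rwa [hy'])
        rwa [hy', ← deriv.fun_neg] at this) x
    linarith
  -- Large positive values blow up to the left, hence the reflection.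
  · have hd : ∀ y, HasDerivAt (fun y => f (-y)) (-deriv f (-y)) y := fun y => by
      exact ((hfd (-y)).hasDerivAt.comp y (hasDerivAt_neg y)).congr_deriv (by simp)
    have := le_of_rpow_sub_le_deriv hγ h₀ hR0 hRγ (g := fun y => f (-y))
      (fun y => (hd y).differentiableAt)
      (fun y hy => by
        have hy' : |f (-y)| = f (-y) := abs_of_pos (by linarith)
        have := key (-y) (by rwa [hy'])
        rwa [hy', ← (hd y).deriv] at this) (-x)
    simpa using this

end Structure

theorem proposition3p4 (γ : ℝ) (hγ : 2 < γ) :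
    ∃ C : ℝ, 0 < C ∧
      ∀ (α₀ α₁ κ : ℝ), 0 < α₀ → 0 < α₁ → 0 < κ →
      ∀ (Ω : Type*) (a : ℝ → Ω → ℝ) (H : ℝ → ℝ → Ω → ℝ),
        IsDiffusionCoeff κ a → IsHamiltonian α₀ α₁ γ H →
      ∀ (ω : Ω) (lam : ℝ), criticalValue a H ω ≤ (lam : EReal) →
        -- the correspondence, wherever the diffusion coefficient is positive
        ((∀ x, 0 < a x ω) → ∀ f : ℝ → ℝ,
          (IsC1Solution (fun x => a x ω) (fun x p => H x p ω) lam f ↔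
            ∃ u : ℝ → ℝ, IsViscositySolution (fun x => a x ω) (fun x p => H x p ω) lam u ∧
              ∀ x, HasDerivAt u (f x) x)) ∧
        -- one of its directions holds also where the coefficient may vanish
        (∀ f : ℝ → ℝ, IsC1Solution (fun x => a x ω) (fun x p => H x p ω) lam f →
          ∃ u : ℝ → ℝ, IsViscositySolution (fun x => a x ω) (fun x p => H x p ω) lam u ∧
            ∀ x, HasDerivAt u (f x) x) ∧
        -- the uniform bound
        0 < gradientBound C α₀ α₁ γ κ lam ∧
        (∀ f : ℝ → ℝ, IsC1Solution (fun x => a x ω) (fun x p => H x p ω) lam f →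
          ∀ x, |f x| ≤ gradientBound C α₀ α₁ γ κ lam) := by
  -- The second term of `K` alone bounds `f`; it vanishes at `lam = -1/α₀`, so the first term
  -- supplies `K > 0`.
  refine ⟨1, one_pos, fun α₀ α₁ κ h₀ h₁ hκ Ω a H ha hH ω lam hlam => ?_⟩
  have hlow := neg_inv_le_of_criticalValue_le hγ h₀ ha hH hlam
  have hbase : 0 ≤ (1 + lam * α₀) / α₀ ^ 2 := by
    have h1 : -(1 / α₀) * α₀ ≤ lam * α₀ := by gcongr
    have h2 : -(1 / α₀) * α₀ = -1 := by field_simp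
    exact div_nonneg (by linarith) (by positivity)
  have hfirst : 0 < (κ * (Real.sqrt (1 + α₁ + |lam|) / α₀)) ^ (2 / (γ - 1)) := by positivity
  have hdirect : ∀ f : ℝ → ℝ, IsC1Solution (fun x => a x ω) (fun x p => H x p ω) lam f →
      ∃ u : ℝ → ℝ, IsViscositySolution (fun x => a x ω) (fun x p => H x p ω) lam u ∧
        ∀ x, HasDerivAt u (f x) x :=
    fun f hf => hf.exists_isViscositySolution fun x => ha.nonneg x ω
  refine ⟨fun hpos f => ⟨hdirect f, ?_⟩, hdirect, ?_, fun f hf x => ?_⟩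
  · rintro ⟨u, hsol, hu⟩
    exact hsol.isC1Solution hγ h₀ ha hH hpos hu
  · rw [gradientBound, one_mul]
    exact add_pos_of_pos_of_nonneg hfirst (Real.rpow_nonneg hbase _)
  · rw [gradientBound, one_mul]
    exact (hf.abs_le_rpow hγ h₀ ha hH hlow x).trans (le_add_of_nonneg_left hfirst.le)
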